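/- **Negative result for weak recovery under Bernoulli testing.** There are $p$ items, and the set $S \subseteq \{1,\dots,p\}$ of defective items is uniformly distributed over the $\binom{p}{k}$ subsets of size $k$. Independently of $S$, a test matrix $\mathbf{X} \in \{0,1\}^{n \times p}$ has i.i.d. $\mathrm{Bernoulli}(\nu/k)$ entries, where $X^{(i)}_j = 1$ means that item $j$ is included in test $i$, and where $0 < \nu \le k$ is such that $(1-\nu/k)^k = \tfrac12$. The outcomes are $\mathbf{Y} = (Y^{(1)},\dots,Y^{(n)})$ with $Y^{(i)} = \bigvee_{j \in S} X^{(i)}_j$. A decoder is a (possibly randomized) map from $(\mathbf{X},\mathbf{Y})$ to an estimate $\widehat{S} \subseteq \{1,\dots,p\}$ (of any size). Fix $\eta \in (0,1)$ and $\alpha \in (0,1)$. Suppose that $p \to \infty$, that $k \to \infty$ with $k = o\big(p^{\eta/(1+\eta)}\big)$, and that $n \le (1-\eta)\log_2\binom{p}{k}$. Then every sequence of decoders satisfies $$\mathbb{P}\Big[\max\big\{|\widehat{S}\setminus S|,\ |S\setminus\widehat{S}|\big\} \le \alpha k\Big] \to 0 .$$ -/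

import Mathlib

open Filter Topology Asymptotics
open scoped ENNReal

namespace GroupTesting

/-- A non-adaptive design with `n` tests on `p` items: `X i j = true` means that item `j` is
included in test `i`. -/
abbrev TestMatrix (n p : ℕ) : Type := Fin n → Fin p → Bool

/-- The outcomes of the noiseless tests when the defective set is `S`: test `i` is positive if and
only if it includes at least one defective item. -/
def outcome {n p : ℕ} (X : TestMatrix n p) (S : Finset (Fin p)) : Fin n → Bool :=
  fun i => decide (∃ j ∈ S, X i j = true)

/-- The mass of a value `b` under the Bernoulli distribution with parameter `q`. -/
noncomputable def bernoulliWeight (q : unitInterval) (b : Bool) : ℝ≥0∞ :=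
  ENNReal.ofReal (if b then (q : ℝ) else 1 - (q : ℝ))

theorem sum_bernoulliWeight (q : unitInterval) : ∑ b : Bool, bernoulliWeight q b = 1 := by
  have h0 := q.2.1
  have h1 := q.2.2
  simp only [bernoulliWeight, Fintype.sum_bool]
  rw [← ENNReal.ofReal_add (by simpa using h0) (by simpa using h1)]
  simp

theorem sum_prod_bernoulliWeight (n p : ℕ) (q : unitInterval) :
    ∑ X : TestMatrix n p, ∏ i, ∏ j, bernoulliWeight q (X i j) = 1 := by
  have row : ∑ x : Fin p → Bool, ∏ j, bernoulliWeight q (x j) = 1 := by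
    rw [← Fintype.piFinset_univ,
      ← Finset.prod_univ_sum (fun _ : Fin p => (Finset.univ : Finset Bool))
        (fun _ b => bernoulliWeight q b)]
    simp only [sum_bernoulliWeight, Finset.prod_const_one]
  rw [← Fintype.piFinset_univ,
    ← Finset.prod_univ_sum (fun _ : Fin n => (Finset.univ : Finset (Fin p → Bool)))
      (fun _ x => ∏ j, bernoulliWeight q (x j))]
  simp only [row, Finset.prod_const_one]

/-- The i.i.d. Bernoulli design: each of the `p` items is placed in each of the `n` tests with
probability `q`, independently over items and tests. -/
noncomputable def bernoulliDesign (n p : ℕ) (q : unitInterval) : PMF (TestMatrix n p) :=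
  PMF.ofFintype (fun X => ∏ i, ∏ j, bernoulliWeight q (X i j)) (sum_prod_bernoulliWeight n p q)

theorem powersetCard_univ_nonempty {p k : ℕ} (hkp : k ≤ p) :
    (Finset.powersetCard k (Finset.univ : Finset (Fin p))).Nonempty :=
  Finset.powersetCard_nonempty.2 (by simpa using hkp)

/-- The prior on the defective set: uniform over the `p.choose k` sets of `k` items. -/
noncomputable def defectiveSet (p k : ℕ) (hkp : k ≤ p) : PMF (Finset (Fin p)) :=
  PMF.uniformOfFinset (Finset.powersetCard k Finset.univ) (powersetCard_univ_nonempty hkp)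

/-- A (possibly randomized) decoder maps the test matrix and the outcomes to the law of its
estimate, which may be any set of items. A deterministic decoder is the case of point masses. -/
abbrev Decoder (n p : ℕ) : Type := TestMatrix n p → (Fin n → Bool) → PMF (Finset (Fin p))

/-- The joint law of the defective set `S` and the estimate `Shat`: `S` is uniform over the sets of
`k` items, the design is i.i.d. Bernoulli and independent of `S`, and the decoder observes only
the design and the outcomes. -/
noncomputable def jointLaw {n p : ℕ} (k : ℕ) (hkp : k ≤ p) (q : unitInterval) (D : Decoder n p) :
    PMF (Finset (Fin p) × Finset (Fin p)) :=
  (defectiveSet p k hkp).bind fun S =>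
    (bernoulliDesign n p q).bind fun X =>
      (D X (outcome X S)).map fun Shat => (S, Shat)

/-- The probability that both `Shat \ S` and `S \ Shat` have at most `α * k` elements. -/
noncomputable def approxRecoveryProb {n p : ℕ} (k : ℕ) (hkp : k ≤ p) (q : unitInterval)
    (D : Decoder n p) (α : ℝ) : ℝ≥0∞ :=
  (jointLaw k hkp q D).toOuterMeasure
    {x | ((max (x.2 \ x.1).card (x.1 \ x.2).card : ℕ) : ℝ) ≤ α * k}

end GroupTesting

/-! A close estimate has at most 2k items and meets S in at least (1 - α)k of them. Cauchy–Schwarz,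
over the items of the estimate (`card_isClose_le`) and then over designs and outcomes
(`sum_isClose_le`), bounds the success probability through a second moment: the average of |S ∩ S'|
over pairs of k-sets, weighted by 2^n times the probability that their outcomes agree.

As a test is negative with probability 1/2, that weight is exactly x^|S ∩ S'| with x = (1 - q)^(-n),
so that x^k = 2^n. The overlap of two random k-sets has generating function at most that of
Binomial(k, k/p), which bounds the average by exp(2xk²/p). The rate gives x ≤ (ep/k)^(1-η), and
sparsity then gives xk²/p ≤ e. The success probability is therefore O(1/√k). -/

theorem sum_piBool_prod {ι : Type*} [Fintype ι] [DecidableEq ι] (f : ι → Bool → ℝ) :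
    ∑ x : ι → Bool, ∏ j, f j (x j) = ∏ j, ∑ b, f j b := by
  rw [Finset.prod_univ_sum, Fintype.piFinset_univ]

/-! ### Probability that two sets of items have equal outcomes -/

namespace GroupTesting

/-- The real mass of a single test (a row of the design) under i.i.d. Bernoulli inclusion. -/
noncomputable def rowWeight {p : ℕ} (q : ℝ) (x : Fin p → Bool) : ℝ :=
  ∏ j, if x j then q else 1 - q

theorem rowWeight_nonneg {p : ℕ} {q : ℝ} (h0 : 0 ≤ q) (h1 : q ≤ 1) (x : Fin p → Bool) :
    0 ≤ rowWeight q x :=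
  Finset.prod_nonneg fun j _ => by split_ifs <;> linarith

theorem sum_rowWeight_avoid {p : ℕ} (q : ℝ) (U : Finset (Fin p)) :
    ∑ x : Fin p → Bool, (if ∃ j ∈ U, x j = true then 0 else rowWeight q x) =
      (1 - q) ^ U.card := by
  have h : ∀ x : Fin p → Bool, (if ∃ j ∈ U, x j = true then 0 else rowWeight q x) =
      ∏ j, (if x j then (if j ∈ U then 0 else q) else 1 - q) := by
    intro x
    split_ifs with hx
    · obtain ⟨j, hj, hxj⟩ := hx
      exact (Finset.prod_eq_zero (Finset.mem_univ j) (by simp [hj, hxj])).symm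
    · refine Finset.prod_congr rfl fun j _ => ?_
      by_cases hj : j ∈ U
      · have : x j ≠ true := fun h => hx ⟨j, hj, h⟩
        simp [this]
      · simp [hj]
  simp_rw [h]
  rw [sum_piBool_prod (fun j b => if b then (if j ∈ U then 0 else q) else 1 - q)]
  have h2 : ∀ j : Fin p, ∑ b : Bool, (if b = true then (if j ∈ U then 0 else q) else 1 - q) =
      if j ∈ U then 1 - q else 1 := by
    intro j
    by_cases hj : j ∈ U <;> simp [hj]
  simp_rw [h2]
  simp

theorem sum_rowWeight {p : ℕ} (q : ℝ) : ∑ x : Fin p → Bool, rowWeight q x = 1 := by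
  simpa using sum_rowWeight_avoid q (∅ : Finset (Fin p))

/-- The probability that two sets of items produce the same outcome of a single test. -/
theorem sum_rowWeight_agree {p : ℕ} (q : ℝ) (S T : Finset (Fin p)) :
    ∑ x : Fin p → Bool,
      (if ((∃ j ∈ S, x j = true) ↔ ∃ j ∈ T, x j = true) then rowWeight q x else 0) =
      1 - (1 - q) ^ S.card - (1 - q) ^ T.card + 2 * (1 - q) ^ (S ∪ T).card := by
  rw [← sum_rowWeight_avoid q S, ← sum_rowWeight_avoid q T, ← sum_rowWeight_avoid q (S ∪ T),
    ← sum_rowWeight (p := p) q, Finset.mul_sum, ← Finset.sum_sub_distrib, ← Finset.sum_sub_distrib,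
    ← Finset.sum_add_distrib]
  refine Finset.sum_congr rfl fun x _ => ?_
  have hU : (∃ j ∈ S ∪ T, x j = true) ↔ (∃ j ∈ S, x j = true) ∨ ∃ j ∈ T, x j = true := by
    simp only [Finset.mem_union, or_and_right, exists_or]
  simp only [hU]
  by_cases h1 : ∃ j ∈ S, x j = true <;> by_cases h2 : ∃ j ∈ T, x j = true <;>
    simp only [h1, h2, if_true, if_false, or_true, true_or, or_self, iff_true, iff_false,
      not_true_eq_false, iff_self] <;> ring

/-- The real mass of a test matrix under the Bernoulli design. -/
noncomputable def designWeight {n p : ℕ} (q : ℝ) (X : TestMatrix n p) : ℝ :=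
  ∏ i, rowWeight q (X i)

theorem designWeight_nonneg {n p : ℕ} {q : ℝ} (h0 : 0 ≤ q) (h1 : q ≤ 1) (X : TestMatrix n p) :
    0 ≤ designWeight q X :=
  Finset.prod_nonneg fun i _ => rowWeight_nonneg h0 h1 (X i)

theorem sum_design_prod {n p : ℕ} (F : (Fin p → Bool) → ℝ) :
    ∑ X : TestMatrix n p, ∏ i, F (X i) = (∑ x, F x) ^ n := by
  have := Finset.prod_univ_sum (fun _ : Fin n => (Finset.univ : Finset (Fin p → Bool)))
    (fun _ x => F x)
  rw [Fintype.piFinset_univ] at this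
  rw [← this]
  simp

theorem sum_designWeight {n p : ℕ} (q : ℝ) :
    ∑ X : TestMatrix n p, designWeight q X = 1 := by
  unfold designWeight
  rw [sum_design_prod, sum_rowWeight, one_pow]

theorem sum_designWeight_agree {n p : ℕ} (q : ℝ) (S T : Finset (Fin p)) :
    ∑ X : TestMatrix n p, (if outcome X S = outcome X T then designWeight q X else 0) =
      (1 - (1 - q) ^ S.card - (1 - q) ^ T.card + 2 * (1 - q) ^ (S ∪ T).card) ^ n := by
  rw [← sum_rowWeight_agree, ← sum_design_prod]
  refine Finset.sum_congr rfl fun X _ => ?_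
  have h : outcome X S = outcome X T ↔
      ∀ i, ((∃ j ∈ S, X i j = true) ↔ ∃ j ∈ T, X i j = true) := by
    simp only [funext_iff, outcome, decide_eq_decide]
  split_ifs with hX
  · rw [h] at hX
    exact Finset.prod_congr rfl fun i _ => (if_pos (hX i)).symm
  · rw [h] at hX
    obtain ⟨i, hi⟩ := not_forall.1 hX
    exact (Finset.prod_eq_zero (Finset.mem_univ i) (if_neg hi)).symm

/-- With density `q` such that a test is negative with probability `1 / 2`, the probability that
two sets of `k` items have the same outcomes depends only on their overlap. -/
theorem two_pow_mul_sum_designWeight_agree {n p k : ℕ} {q : ℝ} (hq : (1 - q) ^ k = 1 / 2) {S T : Finset (Fin p)} (hS : S.card = k) (hT : T.card = k) :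
    2 ^ n * ∑ X : TestMatrix n p, (if outcome X S = outcome X T then designWeight q X else 0) =
      (((1 - q)⁻¹) ^ n) ^ (S ∩ T).card := by
  rw [sum_designWeight_agree, hS, hT, hq, ← mul_pow, ← pow_mul, mul_comm n, pow_mul]
  congr 1
  have hcard := Finset.card_union_add_card_inter S T
  rw [hS, hT] at hcard
  -- The terms 1 - 1/2 - 1/2 cancel, and |S ∪ T| + |S ∩ T| = 2k turns the union term into an overlap
  -- term.
  have h : (1 - q) ^ (S ∪ T).card * (1 - q) ^ (S ∩ T).card = 1 / 4 := by
    rw [← pow_add, hcard, pow_add, hq]; norm_num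
  rw [inv_pow]
  refine eq_inv_of_mul_eq_one_left ?_
  linear_combination 4 * h

/-! ### Second-moment bound for close estimates -/

/-- The estimate `T` is within the allowed numbers of false positives and false negatives. -/
def IsClose {p : ℕ} (k : ℕ) (α : ℝ) (S T : Finset (Fin p)) : Prop :=
  ((max (T \ S).card (S \ T).card : ℕ) : ℝ) ≤ α * k

open Classical in
/-- An estimate is close to few members of a family with small pairwise overlaps. -/
theorem card_isClose_le {p k : ℕ} {α : ℝ} (hα1 : α ≤ 1)
    (F : Finset (Finset (Fin p))) (hF : ∀ S ∈ F, S.card = k) (T : Finset (Fin p)) :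
    (1 - α) * k * ((F.filter fun S => IsClose k α S T).card : ℝ) ≤
      √(2 * k * ∑ S ∈ F, ∑ S' ∈ F, ((S ∩ S').card : ℝ)) := by
  have hk : (0 : ℝ) ≤ k := k.cast_nonneg
  by_cases hne : ∃ S ∈ F, IsClose k α S T
  swap
  · have : (F.filter fun S => IsClose k α S T) = ∅ := by
      rw [Finset.filter_eq_empty_iff]
      exact fun S hS h => hne ⟨S, hS, h⟩
    simp only [this, Finset.card_empty, Nat.cast_zero, mul_zero]
    exact Real.sqrt_nonneg _
  -- One close S suffices: T has at most αk ≤ k items outside it.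
  have hTcard : (T.card : ℝ) ≤ 2 * k := by
    obtain ⟨S, hS, hc⟩ := hne
    have h1 : ((T \ S).card : ℝ) ≤ α * k := le_trans (by exact_mod_cast le_max_left _ _) hc
    have h2 : T.card ≤ (T \ S).card + S.card := by
      rw [← Finset.card_sdiff_add_card_inter T S]
      exact Nat.add_le_add_left (Finset.card_le_card Finset.inter_subset_right) _
    rw [hF S hS] at h2
    have h3 : (T.card : ℝ) ≤ (T \ S).card + k := by exact_mod_cast h2
    nlinarith
  have hsum : (1 - α) * k * ((F.filter fun S => IsClose k α S T).card : ℝ) ≤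
      ∑ S ∈ F, ((S ∩ T).card : ℝ) := by
    rw [mul_comm, ← nsmul_eq_mul, ← Finset.sum_const, Finset.sum_filter]
    refine Finset.sum_le_sum fun S hS => ?_
    split_ifs with hc
    · have h1 : ((S \ T).card : ℝ) ≤ α * k := le_trans (by exact_mod_cast le_max_right _ _) hc
      have h2 := Finset.card_sdiff_add_card_inter S T
      rw [hF S hS] at h2
      have h3 : ((S \ T).card : ℝ) + (S ∩ T).card = k := by exact_mod_cast h2
      linarith
    · positivity
  refine hsum.trans (Real.le_sqrt_of_sq_le ?_)
  have hcard : ∀ A B : Finset (Fin p), ((A ∩ B).card : ℝ) =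
      ∑ j, (if j ∈ A then 1 else 0) * (if j ∈ B then (1 : ℝ) else 0) := by
    intro A B
    simp [← ite_and, ← Finset.mem_inter, Finset.inter_comm]
  -- `N j` is the number of members containing j: overlaps with T sum it over T, while pairwise
  -- overlaps sum its square over all items.
  set N : Fin p → ℝ := fun j => ∑ S ∈ F, if j ∈ S then (1 : ℝ) else 0 with hN
  have e1 : ∑ S ∈ F, ((S ∩ T).card : ℝ) = ∑ j ∈ T, N j := by
    simp_rw [hcard, hN]
    rw [Finset.sum_comm, ← Finset.sum_filter_add_sum_filter_not Finset.univ (· ∈ T)]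
    simp only [Finset.filter_univ_mem]
    rw [Finset.sum_congr rfl (g := N) fun j hj => by simp [hj, hN],
      Finset.sum_eq_zero (s := Finset.univ.filter (· ∉ T)) fun j hj => by
        simp [(Finset.mem_filter.1 hj).2], add_zero]
  have e2 : ∑ S ∈ F, ∑ S' ∈ F, ((S ∩ S').card : ℝ) = ∑ j, N j ^ 2 := by
    simp_rw [hcard, hN, sq, Finset.sum_mul_sum]
    rw [Finset.sum_comm (s := Finset.univ)]
    refine Finset.sum_congr rfl fun S _ => ?_
    rw [Finset.sum_comm]
  rw [e1, e2]
  calc (∑ j ∈ T, N j) ^ 2 ≤ T.card * ∑ j ∈ T, N j ^ 2 := sq_sum_le_card_mul_sum_sq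
    _ ≤ 2 * k * ∑ j, N j ^ 2 := by
      gcongr
      exact Finset.subset_univ _

open Classical in
/-- Second-moment bound on the mass of close estimates, summed over the defective sets. -/
theorem sum_isClose_le {n p k : ℕ} {α q : ℝ} (hα1 : α ≤ 1) (h0 : 0 ≤ q)
    (h1 : q ≤ 1) (A : Finset (Finset (Fin p))) (hA : ∀ S ∈ A, S.card = k)
    (d : TestMatrix n p → (Fin n → Bool) → Finset (Fin p) → ℝ)
    (d0 : ∀ X Y T, 0 ≤ d X Y T) (d1 : ∀ X Y, ∑ T, d X Y T = 1) :
    (1 - α) * k * ∑ S ∈ A, ∑ X : TestMatrix n p, designWeight q X *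
        ∑ T, (if IsClose k α S T then d X (outcome X S) T else 0) ≤
      √(2 * k * ∑ S ∈ A, ∑ S' ∈ A, (S ∩ S').card * (2 ^ n *
        ∑ X : TestMatrix n p, if outcome X S = outcome X S' then designWeight q X else 0)) := by
  set G : TestMatrix n p → (Fin n → Bool) → ℝ := fun X Y =>
    2 * k * ∑ S ∈ A.filter (outcome X · = Y), ∑ S' ∈ A.filter (outcome X · = Y),
      ((S ∩ S').card : ℝ) with hG
  have hG0 : ∀ X Y, 0 ≤ G X Y := fun X Y =>
    mul_nonneg (by positivity) (Finset.sum_nonneg fun _ _ => Finset.sum_nonneg fun _ _ =>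
      Nat.cast_nonneg _)
  have hw := fun X : TestMatrix n p => designWeight_nonneg h0 h1 X
  have step1 : (1 - α) * k * ∑ S ∈ A, ∑ X : TestMatrix n p, designWeight q X *
        ∑ T, (if IsClose k α S T then d X (outcome X S) T else 0) ≤
      ∑ X : TestMatrix n p, ∑ Y, designWeight q X * √(G X Y) := by
    rw [Finset.sum_comm, Finset.mul_sum]
    refine Finset.sum_le_sum fun X _ => ?_
    rw [← Finset.mul_sum, ← Finset.mul_sum, mul_left_comm]
    refine mul_le_mul_of_nonneg_left ?_ (hw X)
    -- All S in one outcome fibre face the same law of the estimate, so the bound for a fixed T can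
    -- be averaged over it.
    rw [← Finset.sum_fiberwise A (fun S => outcome X S), Finset.mul_sum]
    refine Finset.sum_le_sum fun Y _ => ?_
    calc (1 - α) * k * ∑ S ∈ A.filter (outcome X · = Y),
          ∑ T, (if IsClose k α S T then d X (outcome X S) T else 0)
        = ∑ T, d X Y T * ((1 - α) * k *
            (((A.filter (outcome X · = Y)).filter fun S => IsClose k α S T).card : ℝ)) := by
          rw [Finset.sum_comm, Finset.mul_sum]
          refine Finset.sum_congr rfl fun T _ => ?_
          rw [mul_left_comm]
          congr 1
          rw [Finset.card_filter, Nat.cast_sum, Finset.mul_sum]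
          refine Finset.sum_congr rfl fun S hS => ?_
          rw [(Finset.mem_filter.1 hS).2]
          split_ifs <;> simp
      _ ≤ ∑ T, d X Y T * √(G X Y) := by
          refine Finset.sum_le_sum fun T _ => mul_le_mul_of_nonneg_left ?_ (d0 X Y T)
          exact card_isClose_le hα1 _ (fun S hS => hA S (Finset.mem_filter.1 hS).1) T
      _ = √(G X Y) := by rw [← Finset.sum_mul, d1, one_mul]
  refine step1.trans (Real.le_sqrt_of_sq_le ?_)
  simp_rw [← Fintype.sum_prod_type']
  -- Splitting the weight as √w · √w makes the first factor sum to 2^n, one unit of design mass for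
  -- each outcome vector.
  have cs := Finset.sum_mul_sq_le_sq_mul_sq (Finset.univ : Finset (TestMatrix n p × (Fin n → Bool)))
    (fun z => √(designWeight q z.1)) (fun z => √(designWeight q z.1) * √(G z.1 z.2))
  simp only [← mul_assoc, mul_pow, Real.mul_self_sqrt (hw _), Real.sq_sqrt (hw _),
    Real.sq_sqrt (hG0 _ _)] at cs
  refine cs.trans (le_of_eq ?_)
  rw [Fintype.sum_prod_type, Fintype.sum_prod_type]
  simp only [Finset.sum_const, Finset.card_univ, Fintype.card_fun, Fintype.card_bool,
    Fintype.card_fin, nsmul_eq_mul]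
  rw [← Finset.mul_sum, sum_designWeight, mul_one]
  have e : ∀ X : TestMatrix n p, ∑ Y, designWeight q X * G X Y = 2 * k *
      ∑ S ∈ A, ∑ S' ∈ A, (S ∩ S').card *
        (if outcome X S = outcome X S' then designWeight q X else 0) := by
    intro X
    simp only [hG, Finset.sum_filter]
    rw [← Finset.mul_sum, ← Finset.mul_sum, Finset.sum_comm, mul_left_comm, Finset.mul_sum]
    congr 1
    refine Finset.sum_congr rfl fun S _ => ?_
    simp only [Finset.sum_ite_eq, Finset.mem_univ, if_true, Finset.mul_sum]
    refine Finset.sum_congr rfl fun S' _ => ?_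
    by_cases h : outcome X S = outcome X S'
    · simp [h, mul_comm]
    · simp [h, Ne.symm h]
  simp_rw [e]
  rw [← Finset.mul_sum, mul_left_comm]
  congr 1
  rw [Finset.sum_comm, Finset.mul_sum]
  refine Finset.sum_congr rfl fun S _ => ?_
  rw [Finset.sum_comm, Finset.mul_sum]
  refine Finset.sum_congr rfl fun S' _ => ?_
  rw [← Finset.mul_sum]
  push_cast
  ring

open Classical in
theorem approxRecoveryProb_eq {n p k : ℕ} (hkp : k ≤ p) (q : unitInterval) (D : Decoder n p)
    (α : ℝ) :
    approxRecoveryProb k hkp q D α = ENNReal.ofReal (((p.choose k : ℕ) : ℝ)⁻¹ *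
      ∑ S ∈ Finset.powersetCard k (Finset.univ : Finset (Fin p)), ∑ X : TestMatrix n p,
        designWeight q X *
          ∑ T, (if IsClose k α S T then (D X (outcome X S) T).toReal else 0)) := by
  have hwX : ∀ X : TestMatrix n p, bernoulliDesign n p q X = ENNReal.ofReal (designWeight q X) := by
    intro X
    have hq := q.2
    have hb : ∀ b : Bool, 0 ≤ (if b then (q : ℝ) else 1 - (q : ℝ)) := fun b => by
      split_ifs <;> linarith [hq.1, hq.2]
    simp only [bernoulliDesign, PMF.ofFintype_apply, bernoulliWeight, designWeight, rowWeight]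
    rw [ENNReal.ofReal_prod_of_nonneg fun i _ => Finset.prod_nonneg fun j _ => hb _]
    exact Finset.prod_congr rfl fun i _ =>
      (ENNReal.ofReal_prod_of_nonneg fun j _ => hb _).symm
  have hw := fun X : TestMatrix n p => designWeight_nonneg q.2.1 q.2.2 X
  have hin : ∀ S X, 0 ≤ ∑ T, (if IsClose k α S T then (D X (outcome X S) T).toReal else 0) :=
    fun S X => Finset.sum_nonneg fun T _ => by split_ifs <;> simp
  have hD : ∀ S X, ((D X (outcome X S)).map fun T => (S, T)).toOuterMeasure
      {x | ((max (x.2 \ x.1).card (x.1 \ x.2).card : ℕ) : ℝ) ≤ α * k} =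
      ENNReal.ofReal (∑ T, (if IsClose k α S T then (D X (outcome X S) T).toReal else 0)) := by
    intro S X
    rw [PMF.toOuterMeasure_map_apply, PMF.toOuterMeasure_apply_fintype,
      ENNReal.ofReal_sum_of_nonneg fun T _ => by split_ifs <;> simp]
    refine Finset.sum_congr rfl fun T _ => ?_
    by_cases h : IsClose k α S T
    · rw [if_pos h, ENNReal.ofReal_toReal (PMF.apply_ne_top _ _), Set.indicator_of_mem]
      exact h
    · rw [if_neg h, ENNReal.ofReal_zero, Set.indicator_of_notMem]
      exact h
  unfold approxRecoveryProb jointLaw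
  rw [PMF.toOuterMeasure_bind_apply, tsum_fintype]
  simp_rw [PMF.toOuterMeasure_bind_apply, tsum_fintype, hD, hwX, ← ENNReal.ofReal_mul (hw _)]
  simp_rw [← ENNReal.ofReal_sum_of_nonneg (s := (Finset.univ : Finset (TestMatrix n p)))
    fun X _ => mul_nonneg (hw X) (hin _ X)]
  have hC : (0 : ℝ) < (p.choose k : ℕ) := by exact_mod_cast Nat.choose_pos hkp
  rw [ENNReal.ofReal_mul (inv_nonneg.2 hC.le), ENNReal.ofReal_sum_of_nonneg fun S _ =>
      Finset.sum_nonneg fun X _ => mul_nonneg (hw X) (hin _ X), Finset.mul_sum,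
    ENNReal.ofReal_inv_of_pos hC, ENNReal.ofReal_natCast]
  rw [← Finset.sum_subset (Finset.subset_univ (Finset.powersetCard k Finset.univ))]
  · refine Finset.sum_congr rfl fun S hS => ?_
    rw [defectiveSet, PMF.uniformOfFinset_apply_of_mem _ hS]
    simp
  · intro S _ hS
    rw [defectiveSet, PMF.uniformOfFinset_apply_of_notMem _ hS, zero_mul]

end GroupTesting

/-! ### Overlap of random k-sets and binomial estimates -/

/-- A uniformly random `k`-set contains given `t` elements with probability at most `(k / p) ^ t`. -/
theorem choose_sub_le_div_pow {p k t : ℕ} (hkp : k ≤ p) (htk : t ≤ k) :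
    ((p - t).choose (k - t) : ℝ) ≤ p.choose k * ((k : ℝ) / p) ^ t := by
  induction t with
  | zero => simp
  | succ t ih =>
    have ih := ih (by omega)
    obtain ⟨a, rfl⟩ : ∃ a, p = a + t + 1 := ⟨p - t - 1, by omega⟩
    obtain ⟨b, rfl⟩ : ∃ b, k = b + t + 1 := ⟨k - t - 1, by omega⟩
    have e := Nat.add_one_mul_choose_eq a b
    rw [show a + t + 1 - t = a + 1 by omega, show b + t + 1 - t = b + 1 by omega] at ih
    rw [show a + t + 1 - (t + 1) = a by omega, show b + t + 1 - (t + 1) = b by omega]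
    have hab : (b : ℝ) ≤ a := by exact_mod_cast (by omega : b ≤ a)
    have e' : ((a : ℝ) + 1) * a.choose b = (a + 1).choose (b + 1) * (b + 1) := by exact_mod_cast e
    -- Adding t to both parts of a fraction at most 1 cannot decrease it.
    have hr : ((b : ℝ) + 1) / (a + 1) ≤ ((b + t + 1 : ℕ) : ℝ) / ((a + t + 1 : ℕ) : ℝ) := by
      rw [div_le_div_iff₀ (by positivity) (by positivity)]
      push_cast
      nlinarith [(t.cast_nonneg : (0 : ℝ) ≤ t)]
    calc (a.choose b : ℝ) = (a + 1).choose (b + 1) * (((b : ℝ) + 1) / (a + 1)) := by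
          field_simp
          linarith
      _ ≤ _ := by
          rw [pow_succ, ← mul_assoc]
          exact mul_le_mul ih hr (by positivity) (by positivity)

/-- Generating function bound for the overlap of a uniformly random `k`-set with a fixed one. -/
theorem sum_powersetCard_pow_card_inter_le {p k : ℕ} (hkp : k ≤ p) {y : ℝ} (hy : 0 ≤ y)
    {S : Finset (Fin p)} (hS : S.card = k) :
    ∑ T ∈ Finset.powersetCard k (Finset.univ : Finset (Fin p)), (1 + y) ^ (S ∩ T).card ≤
      p.choose k * (1 + y * (k / p)) ^ k := by
  have hexp : ∀ A : Finset (Fin p), ∀ z : ℝ, (1 + z) ^ A.card = ∑ U ∈ A.powerset, z ^ U.card := by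
    intro A z
    rw [← Finset.prod_const, Finset.prod_one_add]
    simp
  have hcount : ∀ U ∈ S.powerset,
      (((Finset.powersetCard k (Finset.univ : Finset (Fin p))).filter (U ⊆ ·)).card : ℝ) ≤
        p.choose k * ((k : ℝ) / p) ^ U.card := by
    intro U hU
    have hUS := Finset.mem_powerset.1 hU
    have hUk : U.card ≤ k := hS ▸ Finset.card_le_card hUS
    refine le_trans ?_ (choose_sub_le_div_pow hkp hUk)
    have : ((Finset.powersetCard k (Finset.univ : Finset (Fin p))).filter (U ⊆ ·)).card ≤
        (Finset.powersetCard (k - U.card) Uᶜ).card := by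
      refine Finset.card_le_card_of_injOn (fun T => T \ U) ?_ ?_
      · intro T hT
        replace hT := Finset.mem_filter.1 hT
        rw [Finset.mem_powersetCard] at hT
        rw [Finset.mem_coe, Finset.mem_powersetCard]
        refine ⟨fun j hj => by simpa using (Finset.mem_sdiff.1 hj).2, ?_⟩
        rw [Finset.card_sdiff_of_subset hT.2, hT.1.2]
      · intro T hT T' hT' h
        replace hT := Finset.mem_filter.1 hT
        replace hT' := Finset.mem_filter.1 hT'
        replace h : T \ U = T' \ U := h
        rw [← Finset.sdiff_union_of_subset hT.2, h, Finset.sdiff_union_of_subset hT'.2]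
    rw [Finset.card_powersetCard, Finset.card_compl, Fintype.card_fin] at this
    exact_mod_cast this
  -- Expand the power over subsets U of S ∩ T, then exchange sums to count the T containing U.
  calc ∑ T ∈ Finset.powersetCard k (Finset.univ : Finset (Fin p)), (1 + y) ^ (S ∩ T).card
      = ∑ T ∈ Finset.powersetCard k (Finset.univ : Finset (Fin p)),
          ∑ U ∈ S.powerset, if U ⊆ T then y ^ U.card else 0 := by
        refine Finset.sum_congr rfl fun T _ => ?_
        rw [hexp, ← Finset.sum_filter]
        refine Finset.sum_congr ?_ fun _ _ => rfl
        ext U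
        rw [Finset.mem_powerset, Finset.mem_filter, Finset.mem_powerset, Finset.subset_inter_iff]
    _ = ∑ U ∈ S.powerset, y ^ U.card *
          (((Finset.powersetCard k (Finset.univ : Finset (Fin p))).filter (U ⊆ ·)).card : ℝ) := by
        rw [Finset.sum_comm]
        refine Finset.sum_congr rfl fun U _ => ?_
        rw [← Finset.sum_filter, Finset.sum_const, nsmul_eq_mul, mul_comm]
    _ ≤ ∑ U ∈ S.powerset, y ^ U.card * (p.choose k * ((k : ℝ) / p) ^ U.card) :=
        Finset.sum_le_sum fun U hU => mul_le_mul_of_nonneg_left (hcount U hU) (by positivity)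
    _ = p.choose k * (1 + y * (k / p)) ^ k := by
        rw [← hS, hexp, hS, Finset.mul_sum]
        refine Finset.sum_congr rfl fun U _ => ?_
        rw [mul_pow]
        ring

/-- Combines C(p,k) ≤ p^k / k! with k^k / k! ≤ e^k, a single term of the exponential series. -/
theorem choose_le_exp_mul_div_pow {p k : ℕ} (hk : 0 < k) :
    (p.choose k : ℝ) ≤ (Real.exp 1 * p / k) ^ k := by
  have hk' : (0 : ℝ) < k := by exact_mod_cast hk
  have h1 := Nat.choose_le_pow_div (α := ℝ) k p
  have h2 := Real.pow_div_factorial_le_exp (k : ℝ) hk'.le k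
  refine h1.trans ?_
  have hf : (0 : ℝ) < k.factorial := by exact_mod_cast k.factorial_pos
  rw [div_pow, mul_pow, ← Real.exp_nat_mul, mul_one, div_le_div_iff₀ hf (by positivity)]
  rw [div_le_iff₀ hf] at h2
  calc (p : ℝ) ^ k * (k : ℝ) ^ k ≤ p ^ k * (Real.exp k * k.factorial) := by gcongr
    _ = _ := by ring

/-! ### Success probability at finite size -/

namespace GroupTesting

theorem approxRecoveryProb_le {n p k : ℕ} (hkp : k ≤ p) (hk : 0 < k) (q : unitInterval)
    (hq : (1 - (q : ℝ)) ^ k = 1 / 2) (D : Decoder n p) {α : ℝ} (hα : α ∈ Set.Ioo (0 : ℝ) 1) :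
    approxRecoveryProb k hkp q D α ≤ ENNReal.ofReal ((1 - α)⁻¹ *
      √(2 * Real.exp (2 * (1 - (q : ℝ))⁻¹ ^ n * k ^ 2 / p) / k)) := by
  classical
  have hk' : (0 : ℝ) < k := by exact_mod_cast hk
  have hp' : (0 : ℝ) < p := by exact_mod_cast hk.trans_le hkp
  have hC : (0 : ℝ) < (p.choose k : ℕ) := by exact_mod_cast Nat.choose_pos hkp
  have ha : 0 < 1 - α := by linarith [hα.2]
  have hq1 : 0 ≤ 1 - (q : ℝ) := by linarith [q.2.2]
  set x : ℝ := (1 - (q : ℝ))⁻¹ ^ n with hx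
  have hx0 : 0 ≤ x := by positivity
  rw [approxRecoveryProb_eq]
  refine ENNReal.ofReal_le_ofReal ?_
  set A := Finset.powersetCard k (Finset.univ : Finset (Fin p)) with hA
  have hAcard : ∀ S ∈ A, S.card = k := fun S hS => (Finset.mem_powersetCard.1 hS).2
  have key := sum_isClose_le hα.2.le q.2.1 q.2.2 A hAcard
    (fun X Y T => (D X Y T).toReal) (fun _ _ _ => ENNReal.toReal_nonneg) (fun X Y => by
      rw [← ENNReal.toReal_sum fun T _ => PMF.apply_ne_top _ _, ← tsum_fintype (L := .unconditional _),
        PMF.tsum_coe, ENNReal.toReal_one])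
  set M := ∑ S ∈ A, ∑ X : TestMatrix n p, designWeight (q : ℝ) X *
    ∑ T, (if IsClose k α S T then (D X (outcome X S) T).toReal else 0) with hM
  have hbound : ∑ S ∈ A, ∑ S' ∈ A, ((S ∩ S').card : ℝ) * (2 ^ n * ∑ X : TestMatrix n p,
      if outcome X S = outcome X S' then designWeight (q : ℝ) X else 0) ≤
      (p.choose k : ℝ) ^ 2 * Real.exp (2 * x * k ^ 2 / p) := by
    calc _ ≤ ∑ S ∈ A, ∑ S' ∈ A, (1 + 2 * x) ^ (S ∩ S').card := by
          refine Finset.sum_le_sum fun S hS => Finset.sum_le_sum fun S' hS' => ?_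
          rw [two_pow_mul_sum_designWeight_agree hq (hAcard S hS) (hAcard S' hS')]
          -- The linear factor is absorbed by doubling the base, whence 2x in the exponent.
          have h2 : ((S ∩ S').card : ℝ) ≤ 2 ^ (S ∩ S').card := by
            exact_mod_cast Nat.lt_two_pow_self.le
          calc _ ≤ 2 ^ (S ∩ S').card * x ^ (S ∩ S').card := by gcongr
            _ = (2 * x) ^ (S ∩ S').card := (mul_pow _ _ _).symm
            _ ≤ _ := by gcongr; linarith
      _ ≤ ∑ S ∈ A, (p.choose k : ℝ) * (1 + 2 * x * (k / p)) ^ k :=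
          Finset.sum_le_sum fun S hS =>
            sum_powersetCard_pow_card_inter_le hkp (by positivity) (hAcard S hS)
      _ = (p.choose k : ℝ) ^ 2 * (1 + 2 * x * (k / p)) ^ k := by
          rw [Finset.sum_const, hA, Finset.card_powersetCard, Finset.card_univ, Fintype.card_fin,
            nsmul_eq_mul]
          ring
      _ ≤ (p.choose k : ℝ) ^ 2 * Real.exp (2 * x * (k / p)) ^ k := by
          gcongr
          rw [add_comm]
          exact Real.add_one_le_exp _
      _ = _ := by
          rw [← Real.exp_nat_mul]
          congr 2
          ring
  have h2 := key.trans (Real.sqrt_le_sqrt (mul_le_mul_of_nonneg_left hbound (by positivity)))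
  have h3 : √(2 * k * ((p.choose k : ℝ) ^ 2 * Real.exp (2 * x * k ^ 2 / p))) =
      k * p.choose k * √(2 * Real.exp (2 * x * k ^ 2 / p) / k) := by
    rw [show 2 * k * ((p.choose k : ℝ) ^ 2 * Real.exp (2 * x * k ^ 2 / p)) =
      (k * p.choose k) ^ 2 * (2 * Real.exp (2 * x * k ^ 2 / p) / k) by field_simp,
      Real.sqrt_mul (by positivity), Real.sqrt_sq (by positivity)]
  rw [h3] at h2
  rw [inv_mul_le_iff₀ hC, ← mul_assoc, mul_comm _ (1 - α)⁻¹, mul_assoc, le_inv_mul_iff₀ ha]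
  refine le_of_mul_le_mul_left ?_ hk'
  linarith

end GroupTesting

/-! ### Rate and sparsity conditions, and the limit -/

/-- Below the rate `1 - η`, the growth factor of the overlap is at most `(e p / k) ^ (1 - η)`. -/
theorem le_exp_mul_div_rpow_of_pow_eq_two_pow {η x : ℝ} {n p k : ℕ} (hη : η ≤ 1) (hk : 0 < k)
    (hkp : k ≤ p) (hxk : x ^ k = 2 ^ n)
    (hn : (n : ℝ) ≤ (1 - η) * Real.logb 2 (p.choose k)) :
    x ≤ (Real.exp 1 * p / k) ^ (1 - η) := by
  have hC : (0 : ℝ) < (p.choose k : ℕ) := by exact_mod_cast Nat.choose_pos hkp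
  refine le_of_pow_le_pow_left₀ hk.ne' (by positivity) ?_
  rw [hxk]
  calc (2 : ℝ) ^ n = (2 : ℝ) ^ (n : ℝ) := (Real.rpow_natCast _ _).symm
    _ ≤ (2 : ℝ) ^ (Real.logb 2 (p.choose k) * (1 - η)) :=
        Real.rpow_le_rpow_of_exponent_le (by norm_num) (by linarith)
    _ = (p.choose k : ℝ) ^ (1 - η) := by
        rw [Real.rpow_mul (by norm_num), Real.rpow_logb (by norm_num) (by norm_num) hC]
    _ ≤ ((Real.exp 1 * p / k) ^ k) ^ (1 - η) :=
        Real.rpow_le_rpow hC.le (choose_le_exp_mul_div_pow hk) (by linarith)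
    _ = ((Real.exp 1 * p / k) ^ (1 - η)) ^ k := by
        rw [← Real.rpow_natCast, ← Real.rpow_natCast, ← Real.rpow_mul (by positivity),
          ← Real.rpow_mul (by positivity), mul_comm (k : ℝ)]

/-- Splitting 2 = (1 - η) + (1 + η) and 1 = (1 - η) + η in the exponents leaves K^(1+η) / P^η, which
is at most 1 exactly at the sparsity threshold. -/
theorem mul_sq_div_le_exp_one {η x P K : ℝ} (hη : η ∈ Set.Ioo (0 : ℝ) 1) (hP : 0 < P) (hK : 0 < K)
    (hsparse : K ≤ P ^ (η / (1 + η))) (hx : x ≤ (Real.exp 1 * P / K) ^ (1 - η)) :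
    x * K ^ 2 / P ≤ Real.exp 1 := by
  have hη0 := hη.1
  have hη1 := hη.2
  have hKP : K ^ (1 + η) ≤ P ^ η := by
    calc K ^ (1 + η) ≤ (P ^ (η / (1 + η))) ^ (1 + η) :=
          Real.rpow_le_rpow hK.le hsparse (by linarith)
      _ = P ^ η := by
          rw [← Real.rpow_mul hP.le, div_mul_cancel₀ _ (by linarith)]
  have he : Real.exp 1 ^ (1 - η) ≤ Real.exp 1 := by
    rw [← Real.exp_mul, one_mul]
    exact Real.exp_le_exp.2 (by linarith)
  have e1 : (Real.exp 1 * P / K) ^ (1 - η) * K ^ 2 / P =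
      Real.exp 1 ^ (1 - η) * (K ^ (1 + η) / P ^ η) := by
    have hK2 : K ^ 2 = K ^ (1 - η) * K ^ (1 + η) := by
      rw [← Real.rpow_add hK, ← Real.rpow_natCast]
      norm_num
    have hP1 : P = P ^ (1 - η) * P ^ η := by
      rw [← Real.rpow_add hP]
      simp
    rw [Real.div_rpow (by positivity) hK.le, Real.mul_rpow (by positivity) hP.le, hK2]
    nth_rewrite 2 [hP1]
    have := Real.rpow_pos_of_pos hP (1 - η)
    have := Real.rpow_pos_of_pos hP η
    have := Real.rpow_pos_of_pos hK (1 - η)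
    field_simp
  calc x * K ^ 2 / P ≤ (Real.exp 1 * P / K) ^ (1 - η) * K ^ 2 / P := by gcongr
    _ = Real.exp 1 ^ (1 - η) * (K ^ (1 + η) / P ^ η) := e1
    _ ≤ Real.exp 1 * 1 := by
        gcongr
        exact div_le_one_of_le₀ hKP (by positivity)
    _ = _ := mul_one _

theorem mainTheorem1
    (η : ℝ) (hη : η ∈ Set.Ioo (0 : ℝ) 1)
    (p k n : ℕ → ℕ) (ν : ℕ → ℝ)
    (hkp : ∀ t, k t ≤ p t)
    (hν : ∀ t, ν t / k t ∈ unitInterval)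
    (hν_half : ∀ t, (1 - ν t / k t) ^ k t = (1 / 2 : ℝ))
    (hn : ∀ t, (n t : ℝ) ≤ (1 - η) * Real.logb 2 ((p t).choose (k t)))
    (hp_top : Tendsto p atTop atTop)
    (hk_top : Tendsto k atTop atTop)
    (hk_sparse : (fun t => (k t : ℝ)) =o[atTop] fun t => (p t : ℝ) ^ (η / (1 + η)))
    (α : ℝ) (hα : α ∈ Set.Ioo (0 : ℝ) 1)
    (D : ∀ t, GroupTesting.Decoder (n t) (p t)) :
    Tendsto
      (fun t => GroupTesting.approxRecoveryProb (k t) (hkp t) ⟨ν t / k t, hν t⟩ (D t) α)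
      atTop (𝓝 0) := by
  have hlim : Tendsto (fun t => ENNReal.ofReal ((1 - α)⁻¹ *
      √(2 * Real.exp (2 * Real.exp 1) / (k t : ℝ)))) atTop (𝓝 0) := by
    rw [← ENNReal.ofReal_zero]
    refine ENNReal.tendsto_ofReal ?_
    have h1 : Tendsto (fun t => 2 * Real.exp (2 * Real.exp 1) / (k t : ℝ)) atTop (𝓝 0) :=
      tendsto_const_nhds.div_atTop (tendsto_natCast_atTop_atTop.comp hk_top)
    simpa using ((Real.continuous_sqrt.tendsto 0).comp h1).const_mul (1 - α)⁻¹
  refine tendsto_of_tendsto_of_tendsto_of_le_of_le' tendsto_const_nhds hlim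
    (Eventually.of_forall fun t => zero_le) ?_
  -- Only k ≤ p^(η/(1+η)) eventually is needed from the little-o; the decay comes from k → ∞.
  filter_upwards [hk_sparse.bound one_pos] with t ht
  have hk : 0 < k t := by
    by_contra h
    have h0 : k t = 0 := by omega
    have := hν_half t
    rw [h0, pow_zero] at this
    norm_num at this
  have hk' : (0 : ℝ) < k t := by exact_mod_cast hk
  have hp' : (0 : ℝ) < p t := by exact_mod_cast hk.trans_le (hkp t)
  rw [one_mul, Real.norm_of_nonneg hk'.le, Real.norm_of_nonneg (by positivity)] at ht
  refine (GroupTesting.approxRecoveryProb_le (hkp t) hk ⟨ν t / k t, hν t⟩ (hν_half t) (D t)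
    hα).trans (ENNReal.ofReal_le_ofReal ?_)
  have ha : 0 < 1 - α := by linarith [hα.2]
  have hq1 : 0 ≤ 1 - ν t / k t := by linarith [(hν t).2]
  have hx := le_exp_mul_div_rpow_of_pow_eq_two_pow hη.2.le hk (hkp t)
    (x := (1 - ν t / k t)⁻¹ ^ n t)
    (by rw [← pow_mul, mul_comm, pow_mul, inv_pow, hν_half]; norm_num) (hn t)
  have hb := mul_sq_div_le_exp_one hη hp' hk' ht hx
  have hb2 : 2 * (1 - ν t / k t)⁻¹ ^ n t * (k t : ℝ) ^ 2 / p t ≤ 2 * Real.exp 1 := by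
    calc _ = 2 * ((1 - ν t / k t)⁻¹ ^ n t * (k t : ℝ) ^ 2 / p t) := by ring
      _ ≤ _ := by gcongr
  dsimp only
  gcongr
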